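/- Let $A$ be a finite alphabet. A rewrite game $G$ over $A$ is given by a finite set of reductions $u\to v$ with $u,v\in A^*$. Its positions are the words over $A$, and a move from a word $w=xuy$ replaces one occurrence of $u$ by $v$, leading to $xvy$, for some reduction $u\to v$ of $G$. Two players move alternately, and the first player unable to move loses. A position is an $\mathcal N$-position if the player who moves first from it has a winning strategy. The game $G$ is strongly terminating if every reduction $u\to v$ of $G$ satisfies $|u|>|v|$. A language $L\subseteq A^*$ is star-free if it can be obtained from $\emptyset$, $\{\varepsilon\}$ and the languages $\{a\}$ with $a\in A$ by finitely many unions, concatenations and complements in $A^*$. Theorem. The following problem is undecidable: given a finite alphabet $A$, a strongly terminating rewrite game $G$ over $A$ and a language $L\subseteq A^*$, decide whether $L$ contains an $\mathcal N$-position of $G$. It remains undecidable when $L$ is restricted to star-free regular languages, whether $L$ is given by a star-free expression, by a regular expression, or by a deterministic finite automaton. That is, for none of these three ways of presenting $L$ is there an algorithm that halts with the correct answer on every instance in which $G$ is strongly terminating and $L$ is star-free. -/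

import Mathlib

/-- A rewrite game over the alphabet `A`: a finite list of reductions `u ⟶ v`. The positions are the
words over `A`; only membership in the list matters. -/
structure RewriteGame (A : Type) where
  rules : List (List A × List A)

namespace RewriteGame

/-- `G.Move w w'`: one occurrence of `u` in `w` is replaced by `v`, for some reduction `u ⟶ v`. -/
def Move {A : Type} (G : RewriteGame A) (w w' : List A) : Prop :=
  ∃ u v x y : List A, (u, v) ∈ G.rules ∧ w = x ++ u ++ y ∧ w' = x ++ v ++ y

/-- Every reduction `u ⟶ v` strictly decreases the length. -/
def StronglyTerminating {A : Type} (G : RewriteGame A) : Prop :=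
  ∀ u v : List A, (u, v) ∈ G.rules → v.length < u.length

/-- `w` is an `N`-position: the player who moves first has a winning strategy, where a player
unable to move loses. That is, she has a move to some `w'` such that every answer `w''` of the
opponent (if there is any) is again winning for the player to move. -/
inductive IsNPosition {A : Type} (G : RewriteGame A) : List A → Prop
  | intro (w w' : List A) (hmove : G.Move w w')
      (hanswer : ∀ w'' : List A, G.Move w' w'' → IsNPosition G w'') : IsNPosition G w

/-- The finite description of a game over the alphabet `{0, …, n - 1}` that an algorithm reads:
its list of reductions, letters being written as natural numbers. -/
def code {n : ℕ} (G : RewriteGame (Fin n)) : List (List ℕ × List ℕ) :=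
  G.rules.map fun r => (r.1.map Fin.val, r.2.map Fin.val)

theorem code_injective (n : ℕ) :
    Function.Injective (code : RewriteGame (Fin n) → List (List ℕ × List ℕ)) := by
  rintro ⟨r⟩ ⟨s⟩ h
  have hw : Function.Injective (List.map (Fin.val : Fin n → ℕ)) :=
    List.map_injective_iff.2 Fin.val_injective
  have hp : Function.Injective
      (fun r : List (Fin n) × List (Fin n) => (r.1.map Fin.val, r.2.map Fin.val)) := by
    rintro ⟨a, b⟩ ⟨c, d⟩ h
    simp only [Prod.mk.injEq] at h
    rw [hw h.1, hw h.2]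
  have := List.map_injective_iff.2 hp h
  subst this
  rfl

end RewriteGame

/-- Star-free expressions over the alphabet `A`: built from the empty set, the empty word and the
letters with union, concatenation and complement. -/
inductive StarFreeExpr (A : Type) : Type
  | empty : StarFreeExpr A
  | epsilon : StarFreeExpr A
  | letter : A → StarFreeExpr A
  | union : StarFreeExpr A → StarFreeExpr A → StarFreeExpr A
  | concat : StarFreeExpr A → StarFreeExpr A → StarFreeExpr A
  | compl : StarFreeExpr A → StarFreeExpr A

namespace StarFreeExpr

/-- The language over `A` denoted by a star-free expression. -/
def lang {A : Type} : StarFreeExpr A → Language A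
  | empty => 0
  | epsilon => 1
  | letter a => {[a]}
  | union e f => e.lang + f.lang
  | concat e f => e.lang * f.lang
  | compl e => {w | w ∉ e.lang}

/-- A star-free expression written in prefix notation. -/
def code {n : ℕ} : StarFreeExpr (Fin n) → List ℕ
  | empty => [0]
  | epsilon => [1]
  | letter a => [2, a.val]
  | union e f => 3 :: (e.code ++ f.code)
  | concat e f => 4 :: (e.code ++ f.code)
  | compl e => 5 :: e.code

theorem code_append {n : ℕ} (e : StarFreeExpr (Fin n)) :
    ∀ (f : StarFreeExpr (Fin n)) (s t : List ℕ), e.code ++ s = f.code ++ t → e = f ∧ s = t := by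
  induction e with
  | empty => intro f s t h; cases f <;> simp_all [code]
  | epsilon => intro f s t h; cases f <;> simp_all [code]
  | letter a => intro f s t h; cases f <;> simp_all [code, Fin.ext_iff]
  | union a b iha ihb =>
    intro f s t h
    cases f <;> simp only [code, List.cons_append, List.append_assoc, List.cons.injEq,
      List.nil_append, OfNat.ofNat_ne_zero, OfNat.ofNat_ne_one, false_and, true_and,
      Nat.reduceEqDiff] at h
    obtain ⟨h1, h2⟩ := iha _ _ _ h
    obtain ⟨h3, h4⟩ := ihb _ _ _ h2
    exact ⟨by rw [h1, h3], h4⟩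
  | concat a b iha ihb =>
    intro f s t h
    cases f <;> simp only [code, List.cons_append, List.append_assoc, List.cons.injEq,
      List.nil_append, OfNat.ofNat_ne_zero, OfNat.ofNat_ne_one, false_and, true_and,
      Nat.reduceEqDiff] at h
    obtain ⟨h1, h2⟩ := iha _ _ _ h
    obtain ⟨h3, h4⟩ := ihb _ _ _ h2
    exact ⟨by rw [h1, h3], h4⟩
  | compl a iha =>
    intro f s t h
    cases f <;> simp only [code, List.cons_append, List.append_assoc, List.cons.injEq,
      List.nil_append, OfNat.ofNat_ne_zero, OfNat.ofNat_ne_one, false_and, true_and,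
      Nat.reduceEqDiff] at h
    obtain ⟨h1, h2⟩ := iha _ _ _ h
    exact ⟨by rw [h1], h2⟩

theorem code_injective (n : ℕ) :
    Function.Injective (code : StarFreeExpr (Fin n) → List ℕ) := by
  intro e f h
  exact (code_append e f [] [] (by rw [h])).1

end StarFreeExpr

/-- A language is star-free if some star-free expression denotes it. -/
def IsStarFree {A : Type} (L : Language A) : Prop :=
  ∃ e : StarFreeExpr A, e.lang = L

/-- A regular expression written in prefix notation. -/
def regexCode {n : ℕ} : RegularExpression (Fin n) → List ℕ
  | RegularExpression.zero => [0]
  | RegularExpression.epsilon => [1]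
  | RegularExpression.char a => [2, a.val]
  | RegularExpression.plus e f => 3 :: (regexCode e ++ regexCode f)
  | RegularExpression.comp e f => 4 :: (regexCode e ++ regexCode f)
  | RegularExpression.star e => 5 :: regexCode e

theorem regexCode_append {n : ℕ} (e : RegularExpression (Fin n)) :
    ∀ (f : RegularExpression (Fin n)) (s t : List ℕ),
      regexCode e ++ s = regexCode f ++ t → e = f ∧ s = t := by
  induction e with
  | zero => intro f s t h; cases f <;> simp_all [regexCode, -RegularExpression.zero_def,
      -RegularExpression.one_def, -RegularExpression.plus_def, -RegularExpression.comp_def]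
  | epsilon => intro f s t h; cases f <;> simp_all [regexCode, -RegularExpression.zero_def,
      -RegularExpression.one_def, -RegularExpression.plus_def, -RegularExpression.comp_def]
  | char a =>
    intro f s t h
    cases f <;> simp only [regexCode, List.cons_append, List.append_assoc, List.cons.injEq,
      List.nil_append, OfNat.ofNat_ne_zero, OfNat.ofNat_ne_one, false_and, true_and,
      Nat.reduceEqDiff] at h
    exact ⟨by rw [Fin.ext h.1], h.2⟩
  | plus a b iha ihb =>
    intro f s t h
    cases f <;> simp only [regexCode, List.cons_append, List.append_assoc, List.cons.injEq,
      List.nil_append, OfNat.ofNat_ne_zero, OfNat.ofNat_ne_one, false_and, true_and,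
      Nat.reduceEqDiff] at h
    obtain ⟨h1, h2⟩ := iha _ _ _ h
    obtain ⟨h3, h4⟩ := ihb _ _ _ h2
    exact ⟨by rw [h1, h3], h4⟩
  | comp a b iha ihb =>
    intro f s t h
    cases f <;> simp only [regexCode, List.cons_append, List.append_assoc, List.cons.injEq,
      List.nil_append, OfNat.ofNat_ne_zero, OfNat.ofNat_ne_one, false_and, true_and,
      Nat.reduceEqDiff] at h
    obtain ⟨h1, h2⟩ := iha _ _ _ h
    obtain ⟨h3, h4⟩ := ihb _ _ _ h2
    exact ⟨by rw [h1, h3], h4⟩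
  | star a iha =>
    intro f s t h
    cases f <;> simp only [regexCode, List.cons_append, List.append_assoc, List.cons.injEq,
      List.nil_append, OfNat.ofNat_ne_zero, OfNat.ofNat_ne_one, false_and, true_and,
      Nat.reduceEqDiff] at h
    obtain ⟨h1, h2⟩ := iha _ _ _ h
    exact ⟨by rw [h1], h2⟩

theorem regexCode_injective (n : ℕ) :
    Function.Injective (regexCode : RegularExpression (Fin n) → List ℕ) := by
  intro e f h
  exact (regexCode_append e f [] [] (by rw [h])).1

open Classical in
/-- A deterministic finite automaton with state set `{0, …, k - 1}`, written as its initial state,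
its transition table (one row per state) and its list of acceptance bits. -/
noncomputable def dfaCode {n : ℕ} (M : Σ k : ℕ, DFA (Fin n) (Fin k)) :
    ℕ × List (List ℕ) × List Bool :=
  (M.2.start.val,
    List.ofFn fun q => List.ofFn fun a => (M.2.step q a).val,
    List.ofFn fun q => decide (q ∈ M.2.accept))

theorem dfaCode_injective (n : ℕ) :
    Function.Injective
      (dfaCode : (Σ k : ℕ, DFA (Fin n) (Fin k)) → ℕ × List (List ℕ) × List Bool) := by
  rintro ⟨k, ⟨st, s, F⟩⟩ ⟨l, ⟨st', s', F'⟩⟩ h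
  simp only [dfaCode, Prod.mk.injEq] at h
  obtain ⟨h1, h2, h3⟩ := h
  have hk : k = l := by simpa using congrArg List.length h2
  subst hk
  have h2' := List.ofFn_injective h2
  have h3' := List.ofFn_injective h3
  have e1 : s = s' := Fin.ext h1
  have e2 : st = st' := by
    funext q a
    exact Fin.ext (congrFun (List.ofFn_injective (congrFun h2' q)) a)
  have e3 : F = F' := by
    ext q
    simpa using congrFun h3' q
  subst e1 e2 e3
  rfl

/-- A way to present languages over the alphabets `{0, …, n - 1}` by finite objects, with an
unambiguous encoding of these objects that algorithms can read. -/
structure LanguagePresentation where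
  /-- the finite objects that present languages over `{0, …, n - 1}` -/
  Obj : ℕ → Type
  /-- the language presented by an object -/
  lang : {n : ℕ} → Obj n → Language (Fin n)
  /-- the type of the encodings -/
  Code : Type
  [primcodable : Primcodable Code]
  /-- the encoding -/
  code : {n : ℕ} → Obj n → Code
  code_injective : ∀ n : ℕ, Function.Injective (code : Obj n → Code)

attribute [instance] LanguagePresentation.primcodable

namespace LanguagePresentation

/-- Languages given by star-free expressions. -/
def byStarFreeExpr : LanguagePresentation where
  Obj n := StarFreeExpr (Fin n)
  lang e := e.lang
  Code := List ℕ
  code e := e.code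
  code_injective := StarFreeExpr.code_injective

/-- Languages given by regular expressions. -/
def byRegularExpression : LanguagePresentation where
  Obj n := RegularExpression (Fin n)
  lang e := e.matches'
  Code := List ℕ
  code e := regexCode e
  code_injective := regexCode_injective

/-- Languages given by deterministic finite automata. -/
noncomputable def byDFA : LanguagePresentation where
  Obj n := Σ k : ℕ, DFA (Fin n) (Fin k)
  lang M := M.2.accepts
  Code := ℕ × List (List ℕ) × List Bool
  code M := dfaCode M
  code_injective := dfaCode_injective

end LanguagePresentation

/-- Given a strongly terminating rewrite game and a star-free language `L` presented through `P`,
it is decidable whether `L` contains an `N`-position: some partial recursive `f` halts with the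
correct answer on every such instance (its behaviour on other inputs is irrelevant). -/
def DecidableNPositionInStarFree (P : LanguagePresentation) : Prop :=
  ∃ f : ℕ × List (List ℕ × List ℕ) × P.Code →. Bool, Partrec f ∧
    ∀ (n : ℕ) (G : RewriteGame (Fin n)) (x : P.Obj n),
      G.StronglyTerminating → IsStarFree (P.lang x) →
        ∃ b : Bool, b ∈ f (n, G.code, P.code x) ∧
          (b = true ↔ ∃ w : List (Fin n), w ∈ P.lang x ∧ G.IsNPosition w)

/-!
The halting problem of a Turing machine is reduced to the question whether a fixed language contains
an `N`-position, the machine and the language being fixed and the input being coded in a single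
reduction of the game.

A run of the machine is a derivation `s →* e` of a rewriting system on words that describe
configurations (`rewrites_haltedWord_iff`). As in the reduction to Post's correspondence problem,
such a derivation exists if and only if there are a list `I` of indices and a text `x` such that
`x = u(I) ++ e` and `x = s ++ v(I)`, where `u(I)` and `v(I)` concatenate words `u i` and `v i` along
`I` (`RewriteGame.rewrites_iff_exists_index`): the text lists the successive words of the
derivation.

The pair `(I, x)` is the content of a word of the language, with `I` written backwards on the left
of a control letter and `x` on its right. In the comparison game, the opponent chooses which of the
two equations has to be checked. Then all moves are forced: the first player removes an index `i`
on the left of the control letter together with the word `u i`, or `v i`, on its right, and leaves a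
padding letter that the opponent has to delete. So she is the only one who can get stuck before the
end, and she makes the last move exactly when the equation holds
(`isNPosition_comparisonWord_iff`). Since the words `u i` and `v i` are nonempty, every
reduction shortens the word.

The words that have the right shape form a language `l · P* · m · Q* · r` with letters `l`, `r`, a
word `m` and sets `P`, `Q` of letters. It is given by a regular expression, and by a star-free
expression since `P*` is the set of words that avoid the letters outside `P`; star-free languages
have finitely many left quotients, which provides the automaton. The machine comes from the
translation of partial recursive functions into Turing machines in Mathlib
(`Turing.exists_machine_not_computablePred`).
-/

/-! ### A game that compares two concatenations -/

/-- If a letter `d` outside the range of an injective `f` ends the first block of letters `f t` on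
the left-hand side, then the block `u.map f` on the right-hand side is a prefix of that block. -/
theorem List.exists_eq_append_of_map_append_cons_eq {T X : Type*} {f : T → X}
    (hf : Function.Injective f) {d : X} (hd : ∀ t, f t ≠ d) {x u : List T} {y z : List X}
    (h : x.map f ++ d :: z = u.map f ++ y) : ∃ x', x = u ++ x' ∧ y = x'.map f ++ d :: z := by
  induction u generalizing x with
  | nil => exact ⟨x, rfl, by simpa using h.symm⟩
  | cons a u ih =>
    cases x with
    | nil => simp only [map_nil, nil_append, map_cons, cons_append, cons.injEq] at h
             exact absurd h.1.symm (hd a)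
    | cons b x =>
      simp only [map_cons, cons_append, cons.injEq] at h
      obtain ⟨x', rfl, hy⟩ := ih h.2
      exact ⟨x', by rw [hf h.1]; rfl, hy⟩

theorem RewriteGame.isNPosition_iff {A : Type} {G : RewriteGame A} {w : List A} :
    G.IsNPosition w ↔ ∃ w', G.Move w w' ∧ ∀ w'', G.Move w' w'' → G.IsNPosition w'' :=
  ⟨fun ⟨_, w', h, h'⟩ => ⟨w', h, h'⟩, fun ⟨w', h, h'⟩ => ⟨w, w', h, h'⟩⟩

/-- The control letters of the comparison game. Every position that matters contains exactly one of
them, and it tells whose turn it is and what is being checked. -/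
inductive Control
  /-- the initial control letter -/
  | start
  /-- the opponent chooses which check to play -/
  | choose
  /-- first player, top check: match the next index and its top word -/
  | top
  /-- opponent, top check: return the control to the first player -/
  | topWait
  /-- first player, bottom check: match the prefix `s` of the text -/
  | botInit
  /-- first player, bottom check: match the next index and its bottom word -/
  | bot
  /-- opponent, bottom check: return the control to the first player -/
  | botWait

/-- The letters of the comparison game: end markers, a padding letter, control letters, indices of
pairs of words, and letters of the text. -/
inductive GameLetter (ι T : Type)
  | leftEnd : GameLetter ι T
  | rightEnd : GameLetter ι T
  | pad : GameLetter ι T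
  | ctrl : Control → GameLetter ι T
  | idx : ι → GameLetter ι T
  | txt : T → GameLetter ι T

namespace GameLetter

instance (ι T : Type) [Finite ι] [Finite T] : Finite (GameLetter ι T) := by
  let f : Option (Option (Option ((Fin 7 ⊕ ι) ⊕ T))) → GameLetter ι T
    | none => leftEnd
    | some none => rightEnd
    | some (some none) => pad
    | some (some (some (.inl (.inl k)))) =>
      ctrl (![.start, .choose, .top, .topWait, .botInit, .bot, .botWait] k)
    | some (some (some (.inl (.inr i)))) => idx i
    | some (some (some (.inr t))) => txt t
  refine Finite.of_surjective f fun a => ?_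
  cases a with
  | leftEnd => exact ⟨none, rfl⟩
  | rightEnd => exact ⟨some none, rfl⟩
  | pad => exact ⟨some (some none), rfl⟩
  | ctrl c =>
    cases c
    exacts [⟨some (some (some (.inl (.inl 0)))), rfl⟩, ⟨some (some (some (.inl (.inl 1)))), rfl⟩,
      ⟨some (some (some (.inl (.inl 2)))), rfl⟩, ⟨some (some (some (.inl (.inl 3)))), rfl⟩,
      ⟨some (some (some (.inl (.inl 4)))), rfl⟩, ⟨some (some (some (.inl (.inl 5)))), rfl⟩,
      ⟨some (some (some (.inl (.inl 6)))), rfl⟩]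
  | idx i => exact ⟨some (some (some (.inl (.inr i)))), rfl⟩
  | txt t => exact ⟨some (some (some (.inr t))), rfl⟩

theorem txt_injective {ι T : Type} : Function.Injective (txt : T → GameLetter ι T) :=
  fun _ _ h => by injection h

end GameLetter

open GameLetter

/-- A tuple `(p, c, q, r)` stands for the reduction `p ++ ctrl c :: q ⟶ r`. -/
abbrev ControlRule (ι T : Type) :=
  List (GameLetter ι T) × Control × List (GameLetter ι T) × List (GameLetter ι T)

/-- The reductions of the comparison game that do not depend on `s`. Except for the winning moves,
which remove the control letter, each move of the first player leaves a padding letter on the right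
of the control letter, so that the opponent has a move, which deletes it. -/
noncomputable def fixedRules {ι T : Type} [Fintype ι] (u v : ι → List T) (e : List T) :
    List (ControlRule ι T) :=
  [([], .start, [pad, pad], [ctrl .choose, pad]),
    ([], .choose, [pad], [ctrl .top]),
    ([], .choose, [pad], [ctrl .botInit]),
    ([], .topWait, [pad], [ctrl .top]),
    ([], .botWait, [pad], [ctrl .bot]),
    ([leftEnd], .top, e.map txt ++ [rightEnd], []),
    ([leftEnd], .bot, [rightEnd], [])] ++
  (Finset.univ.toList.map fun i => ([idx i], .top, (u i).map txt, [ctrl .topWait, pad])) ++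
  (Finset.univ.toList.map fun i => ([idx i], .bot, (v i).map txt, [ctrl .botWait, pad]))

/-- The comparison game. From the position `comparisonWord I x`, the opponent of the first player
decides which of the equations `x = u(I) ++ e` and `x = s ++ v(I)` is checked, where `u(I)` and
`v(I)` are the concatenations of the words `u i` and `v i` along the list `I`. The check is played
with forced moves; the first player is stuck as soon as it fails. -/
noncomputable def comparisonGame {ι T : Type} [Fintype ι] (u v : ι → List T) (e s : List T) :
    RewriteGame (GameLetter ι T) where
  rules := ((([], .botInit, s.map txt, [ctrl .botWait, pad]) : ControlRule ι T) ::
    fixedRules u v e).map fun r => (r.1 ++ ctrl r.2.1 :: r.2.2.1, r.2.2.2)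

/-- The part of a position on the left of the control letter. The list of indices is reversed, so
that its first index is next to the control letter. -/
def leftPart {ι T : Type} (I : List ι) : List (GameLetter ι T) := leftEnd :: I.reverse.map idx

/-- The part of a position on the right of the control letter, up to padding letters. -/
def rightPart {ι T : Type} (x : List T) : List (GameLetter ι T) := x.map txt ++ [rightEnd]

/-- The position in which the first player claims `x = u(I) ++ e` and `x = s ++ v(I)`. -/
def comparisonWord {ι T : Type} (I : List ι) (x : List T) : List (GameLetter ι T) :=
  leftPart I ++ ctrl .start :: pad :: pad :: rightPart x

section Parts

variable {ι T : Type}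

theorem ctrl_notMem_leftPart (c : Control) (I : List ι) :
    (ctrl c : GameLetter ι T) ∉ leftPart I := by
  simp [leftPart]

theorem ctrl_notMem_rightPart (c : Control) (x : List T) :
    (ctrl c : GameLetter ι T) ∉ rightPart x := by
  simp [rightPart]

theorem rightPart_eq_append_iff {x z : List T} {y : List (GameLetter ι T)} :
    rightPart x = z.map txt ++ y ↔ ∃ x', x = z ++ x' ∧ y = rightPart x' := by
  constructor
  · exact List.exists_eq_append_of_map_append_cons_eq txt_injective (by simp)
  · rintro ⟨x', rfl, rfl⟩
    simp [rightPart]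

theorem rightPart_eq_append_rightEnd_iff {x z : List T} {y : List (GameLetter ι T)} :
    rightPart x = z.map txt ++ rightEnd :: y ↔ x = z ∧ y = [] := by
  rw [rightPart_eq_append_iff]
  constructor
  · rintro ⟨x', rfl, h⟩
    cases x' <;> simp_all [rightPart]
  · rintro ⟨rfl, rfl⟩
    exact ⟨[], by simp, rfl⟩

theorem leftPart_cons (i : ι) (I : List ι) :
    (leftPart (i :: I) : List (GameLetter ι T)) = leftPart I ++ [idx i] := by
  simp [leftPart]

theorem leftPart_eq_append_idx_iff {I : List ι} {i : ι} {y : List (GameLetter ι T)} :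
    leftPart I = y ++ [idx i] ↔ ∃ I', I = i :: I' ∧ y = leftPart I' := by
  cases I with
  | nil => simp [leftPart, List.cons_eq_append_iff]
  | cons j I =>
    rw [leftPart_cons]
    constructor
    · intro h
      obtain ⟨h1, h2⟩ := List.append_inj' h rfl
      simp only [List.cons.injEq, idx.injEq, and_true] at h2
      exact ⟨I, by rw [h2], h1.symm⟩
    · rintro ⟨I', h, rfl⟩
      cases h
      rfl

theorem leftPart_eq_append_leftEnd_iff {I : List ι} {y : List (GameLetter ι T)} :
    leftPart I = y ++ [leftEnd] ↔ I = [] ∧ y = [] := by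
  cases I with
  | nil => simp [leftPart]
  | cons j I =>
    rw [leftPart_cons]
    refine iff_of_false (fun h => ?_) (by simp)
    simpa using (List.append_inj' h rfl).2

end Parts

section Comparison

variable {ι T : Type} [Fintype ι] {u v : ι → List T} {e s : List T}

theorem comparisonGame_stronglyTerminating (hu : ∀ i, u i ≠ []) (hv : ∀ i, v i ≠ [])
    (hs : 2 ≤ s.length) : (comparisonGame u v e s).StronglyTerminating := by
  intro a b hab
  have hu' : ∀ i, 0 < (u i).length := fun i => List.length_pos_iff.2 (hu i)
  have hv' : ∀ i, 0 < (v i).length := fun i => List.length_pos_iff.2 (hv i)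
  simp only [comparisonGame, fixedRules, List.mem_map, List.mem_append, List.mem_cons,
    List.not_mem_nil, or_false, Prod.mk.injEq] at hab
  obtain ⟨r, (rfl | (((rfl | rfl | rfl | rfl | rfl | rfl | rfl) | ⟨i, -, rfl⟩) | ⟨i, -, rfl⟩)),
    rfl, rfl⟩ := hab <;> simp <;> grind

/-- The moves from a position with exactly one control letter apply a reduction at that letter. -/
theorem comparisonGame_move_iff {α β w : List (GameLetter ι T)} {c : Control}
    (hα : ∀ c, ctrl c ∉ α) (hβ : ∀ c, ctrl c ∉ β) :
    (comparisonGame u v e s).Move (α ++ ctrl c :: β) w ↔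
      ∃ p q r x y, (p, c, q, r) ∈ (([], .botInit, s.map txt, [ctrl .botWait, pad]) ::
        fixedRules u v e : List (ControlRule ι T)) ∧ α = x ++ p ∧ β = q ++ y ∧
        w = x ++ r ++ y := by
  constructor
  · rintro ⟨a, b, x, y, hab, h, rfl⟩
    obtain ⟨⟨p, c', q, r⟩, hr, hab⟩ := List.mem_map.1 hab
    obtain ⟨rfl, rfl⟩ := Prod.mk.inj hab
    have h' : α ++ ctrl c :: β = (x ++ p) ++ ctrl c' :: (q ++ y) := by simp [h]
    rw [List.append_cons_inj_of_notMem (hα c') (hβ c')] at h'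
    obtain ⟨h1, h2, h3⟩ := h'
    cases h2
    exact ⟨p, q, r, x, y, hr, h1, h3, rfl⟩
  · rintro ⟨p, q, r, x, y, hr, rfl, rfl, rfl⟩
    exact ⟨_, _, x, y, List.mem_map_of_mem hr, by simp, rfl⟩

theorem comparisonGame_not_move_of_forall_notMem {w w' : List (GameLetter ι T)}
    (hw : ∀ c, ctrl c ∉ w) : ¬ (comparisonGame u v e s).Move w w' := by
  rintro ⟨a, b, x, y, hab, h, rfl⟩
  obtain ⟨⟨p, c', q, r⟩, hr, hab⟩ := List.mem_map.1 hab
  obtain ⟨rfl, rfl⟩ := Prod.mk.inj hab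
  exact hw c' (by simp [h])

theorem move_topWait_iff {I : List ι} {x : List T} {w : List (GameLetter ι T)} :
    (comparisonGame u v e s).Move (leftPart I ++ ctrl .topWait :: pad :: rightPart x) w ↔
      w = leftPart I ++ ctrl .top :: rightPart x := by
  rw [comparisonGame_move_iff (fun c => ctrl_notMem_leftPart c I)
    (fun c => by simp [ctrl_notMem_rightPart])]
  simp [fixedRules]

theorem move_botWait_iff {I : List ι} {x : List T} {w : List (GameLetter ι T)} :
    (comparisonGame u v e s).Move (leftPart I ++ ctrl .botWait :: pad :: rightPart x) w ↔
      w = leftPart I ++ ctrl .bot :: rightPart x := by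
  rw [comparisonGame_move_iff (fun c => ctrl_notMem_leftPart c I)
    (fun c => by simp [ctrl_notMem_rightPart])]
  simp [fixedRules]

theorem move_start_iff {I : List ι} {x : List T} {w : List (GameLetter ι T)} :
    (comparisonGame u v e s).Move (comparisonWord I x) w ↔
      w = leftPart I ++ ctrl .choose :: pad :: rightPart x := by
  rw [comparisonWord, comparisonGame_move_iff (fun c => ctrl_notMem_leftPart c I)
    (fun c => by simp [ctrl_notMem_rightPart])]
  simp [fixedRules]

theorem move_choose_iff {I : List ι} {x : List T} {w : List (GameLetter ι T)} :
    (comparisonGame u v e s).Move (leftPart I ++ ctrl .choose :: pad :: rightPart x) w ↔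
      w = leftPart I ++ ctrl .top :: rightPart x ∨
      w = leftPart I ++ ctrl .botInit :: rightPart x := by
  rw [comparisonGame_move_iff (fun c => ctrl_notMem_leftPart c I)
    (fun c => by simp [ctrl_notMem_rightPart])]
  simp [fixedRules, or_and_right, exists_or]

theorem move_botInit_iff {I : List ι} {x : List T} {w : List (GameLetter ι T)} :
    (comparisonGame u v e s).Move (leftPart I ++ ctrl .botInit :: rightPart x) w ↔
      ∃ x', x = s ++ x' ∧ w = leftPart I ++ ctrl .botWait :: pad :: rightPart x' := by
  rw [comparisonGame_move_iff (fun c => ctrl_notMem_leftPart c I)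
    (fun c => by simp [ctrl_notMem_rightPart])]
  simp [fixedRules, rightPart_eq_append_iff]

theorem move_top_iff {I : List ι} {x : List T} {w : List (GameLetter ι T)} :
    (comparisonGame u v e s).Move (leftPart I ++ ctrl .top :: rightPart x) w ↔
      (I = [] ∧ x = e ∧ w = []) ∨
      ∃ i I' x', I = i :: I' ∧ x = u i ++ x' ∧
        w = leftPart I' ++ ctrl .topWait :: pad :: rightPart x' := by
  rw [comparisonGame_move_iff (fun c => ctrl_notMem_leftPart c I)
    (fun c => by simp [ctrl_notMem_rightPart])]
  constructor
  · rintro ⟨p, q, r, a, b, hr, h1, h2, rfl⟩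
    simp [fixedRules] at hr
    obtain ⟨rfl, rfl, rfl⟩ | ⟨i, rfl, rfl, rfl⟩ := hr
    · rw [leftPart_eq_append_leftEnd_iff] at h1
      rw [List.append_assoc, List.singleton_append, rightPart_eq_append_rightEnd_iff] at h2
      exact .inl ⟨h1.1, h2.1, by simp [h1.2, h2.2]⟩
    · obtain ⟨I', rfl, rfl⟩ := leftPart_eq_append_idx_iff.1 h1
      obtain ⟨x', rfl, rfl⟩ := rightPart_eq_append_iff.1 h2
      exact .inr ⟨i, I', x', rfl, rfl, by simp⟩
  · rintro (⟨rfl, rfl, rfl⟩ | ⟨i, I', x', rfl, rfl, rfl⟩)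
    · exact ⟨[leftEnd], x.map txt ++ [rightEnd], [], [], [], by simp [fixedRules],
        by simp [leftPart], by simp [rightPart], rfl⟩
    · exact ⟨[idx i], (u i).map txt, [ctrl .topWait, pad], leftPart I', rightPart x',
        by simp [fixedRules], leftPart_cons i I', by simp [rightPart], by simp⟩

theorem move_bot_iff {I : List ι} {x : List T} {w : List (GameLetter ι T)} :
    (comparisonGame u v e s).Move (leftPart I ++ ctrl .bot :: rightPart x) w ↔
      (I = [] ∧ x = [] ∧ w = []) ∨
      ∃ i I' x', I = i :: I' ∧ x = v i ++ x' ∧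
        w = leftPart I' ++ ctrl .botWait :: pad :: rightPart x' := by
  rw [comparisonGame_move_iff (fun c => ctrl_notMem_leftPart c I)
    (fun c => by simp [ctrl_notMem_rightPart])]
  constructor
  · rintro ⟨p, q, r, a, b, hr, h1, h2, rfl⟩
    simp [fixedRules] at hr
    obtain ⟨rfl, rfl, rfl⟩ | ⟨i, rfl, rfl, rfl⟩ := hr
    · rw [leftPart_eq_append_leftEnd_iff] at h1
      have h2' := (rightPart_eq_append_rightEnd_iff (z := []) (y := b)).1 h2
      exact .inl ⟨h1.1, h2'.1, by simp [h1.2, h2'.2]⟩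
    · obtain ⟨I', rfl, rfl⟩ := leftPart_eq_append_idx_iff.1 h1
      obtain ⟨x', rfl, rfl⟩ := rightPart_eq_append_iff.1 h2
      exact .inr ⟨i, I', x', rfl, rfl, by simp⟩
  · rintro (⟨rfl, rfl, rfl⟩ | ⟨i, I', x', rfl, rfl, rfl⟩)
    · exact ⟨[leftEnd], [rightEnd], [], [], [], by simp [fixedRules],
        by simp [leftPart], by simp [rightPart], rfl⟩
    · exact ⟨[idx i], (v i).map txt, [ctrl .botWait, pad], leftPart I', rightPart x',
        by simp [fixedRules], leftPart_cons i I', by simp [rightPart], by simp⟩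

theorem isNPosition_top_iff {I : List ι} {x : List T} :
    (comparisonGame u v e s).IsNPosition (leftPart I ++ ctrl .top :: rightPart x) ↔
      x = I.flatMap u ++ e := by
  induction I generalizing x with
  | nil =>
    rw [RewriteGame.isNPosition_iff]
    simp only [move_top_iff, reduceCtorEq, false_and, exists_false, or_false, true_and,
      List.flatMap_nil, List.nil_append]
    constructor
    · rintro ⟨w, ⟨rfl, -⟩, -⟩
      rfl
    · rintro rfl
      exact ⟨[], ⟨rfl, rfl⟩, fun w h =>
        absurd h (comparisonGame_not_move_of_forall_notMem (by simp))⟩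
  | cons i I ih =>
    rw [RewriteGame.isNPosition_iff]
    simp only [move_top_iff, reduceCtorEq, false_and, false_or, List.flatMap_cons]
    constructor
    · rintro ⟨_, ⟨_, _, x', h, rfl, rfl⟩, hw⟩
      cases h
      rw [ih.1 (hw _ (move_topWait_iff.2 rfl)), List.append_assoc]
    · rintro rfl
      refine ⟨_, ⟨i, I, I.flatMap u ++ e, rfl, by simp, rfl⟩, fun w hw => ?_⟩
      rw [move_topWait_iff.1 hw, ih]

theorem isNPosition_bot_iff {I : List ι} {x : List T} :
    (comparisonGame u v e s).IsNPosition (leftPart I ++ ctrl .bot :: rightPart x) ↔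
      x = I.flatMap v := by
  induction I generalizing x with
  | nil =>
    rw [RewriteGame.isNPosition_iff]
    simp only [move_bot_iff, reduceCtorEq, false_and, exists_false, or_false, true_and,
      List.flatMap_nil]
    constructor
    · rintro ⟨w, ⟨rfl, -⟩, -⟩
      rfl
    · rintro rfl
      exact ⟨[], ⟨rfl, rfl⟩, fun w h =>
        absurd h (comparisonGame_not_move_of_forall_notMem (by simp))⟩
  | cons i I ih =>
    rw [RewriteGame.isNPosition_iff]
    simp only [move_bot_iff, reduceCtorEq, false_and, false_or, List.flatMap_cons]
    constructor
    · rintro ⟨_, ⟨_, _, x', h, rfl, rfl⟩, hw⟩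
      cases h
      rw [ih.1 (hw _ (move_botWait_iff.2 rfl))]
    · rintro rfl
      refine ⟨_, ⟨i, I, I.flatMap v, rfl, rfl, rfl⟩, fun w hw => ?_⟩
      rw [move_botWait_iff.1 hw, ih]

theorem isNPosition_botInit_iff {I : List ι} {x : List T} :
    (comparisonGame u v e s).IsNPosition (leftPart I ++ ctrl .botInit :: rightPart x) ↔
      x = s ++ I.flatMap v := by
  rw [RewriteGame.isNPosition_iff]
  simp only [move_botInit_iff]
  constructor
  · rintro ⟨_, ⟨x', rfl, rfl⟩, hw⟩
    rw [isNPosition_bot_iff.1 (hw _ (move_botWait_iff.2 rfl))]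
  · rintro rfl
    refine ⟨_, ⟨_, rfl, rfl⟩, fun w hw => ?_⟩
    rw [move_botWait_iff.1 hw, isNPosition_bot_iff]

/-- The first player wins from `comparisonWord I x` exactly when both equations hold. -/
theorem isNPosition_comparisonWord_iff {I : List ι} {x : List T} :
    (comparisonGame u v e s).IsNPosition (comparisonWord I x) ↔
      x = I.flatMap u ++ e ∧ x = s ++ I.flatMap v := by
  rw [RewriteGame.isNPosition_iff]
  simp only [move_start_iff, exists_eq_left, move_choose_iff, forall_eq_or_imp, forall_eq,
    isNPosition_top_iff, isNPosition_botInit_iff]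

end Comparison

/-! ### Reachability by rewriting as a comparison of concatenations -/

namespace RewriteGame

variable {B : Type}

/-- `G.Rewrites w w'`: the word `w'` is obtained from `w` by finitely many moves of `G`. Here `G` is
seen as a rewriting system, and need not terminate. -/
def Rewrites (G : RewriteGame B) : List B → List B → Prop := Relation.ReflTransGen G.Move

theorem Rewrites.trans {G : RewriteGame B} {w w' w'' : List B} (h : G.Rewrites w w')
    (h' : G.Rewrites w' w'') : G.Rewrites w w'' :=
  Relation.ReflTransGen.trans h h'

theorem Rewrites.of_mem {G : RewriteGame B} {u v : List B} (h : (u, v) ∈ G.rules)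
    (a b : List B) : G.Rewrites (a ++ u ++ b) (a ++ v ++ b) :=
  .single ⟨u, v, a, b, h, rfl, rfl⟩

/-- The indices of the pairs of words that spell derivations of `G`: a separator, a letter that is
copied, or a rule that is applied. -/
abbrev DerivationIndex (G : RewriteGame B) : Type := Option (B ⊕ {r // r ∈ G.rules})

instance (G : RewriteGame B) : Finite {r // r ∈ G.rules} := G.rules.finite_toSet

/-- The word of a pair that is read from the current word of a derivation; `none` is the separator
between consecutive words. -/
def readWord (G : RewriteGame B) : G.DerivationIndex → List (Option B)
  | none => [none]
  | some (.inl b) => [some b]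
  | some (.inr r) => r.1.1.map some

/-- The word of a pair that is written into the next word of a derivation. -/
def writeWord (G : RewriteGame B) : G.DerivationIndex → List (Option B)
  | none => [none]
  | some (.inl b) => [some b]
  | some (.inr r) => r.1.2.map some

theorem flatMap_readWord_inl (G : RewriteGame B) (x : List B) :
    (x.map fun b => some (.inl b)).flatMap G.readWord = x.map some := by
  induction x with
  | nil => rfl
  | cons a x ih => simpa [readWord] using ih

theorem flatMap_writeWord_inl (G : RewriteGame B) (x : List B) :
    (x.map fun b => some (.inl b)).flatMap G.writeWord = x.map some := by
  induction x with
  | nil => rfl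
  | cons a x ih => simpa [writeWord] using ih

/-- The text lists the words of a derivation. It is read with the last word put aside, and written
with the first word put aside. -/
theorem Rewrites.exists_index {G : RewriteGame B} {s e : List B} (h : G.Rewrites s e) :
    ∃ I : List G.DerivationIndex, I.flatMap G.readWord ++ (e.map some ++ [none]) =
      (s.map some ++ [none]) ++ I.flatMap G.writeWord := by
  induction h using Relation.ReflTransGen.head_induction_on with
  | refl => exact ⟨[], by simp⟩
  | head h _ ih =>
    obtain ⟨u, v, x, y, hr, rfl, rfl⟩ := h
    obtain ⟨I, hI⟩ := ih
    refine ⟨(x.map fun b => some (.inl b)) ++ some (.inr ⟨_, hr⟩) ::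
      ((y.map fun b => some (.inl b)) ++ none :: I), ?_⟩
    simp only [List.flatMap_append, List.flatMap_cons, flatMap_readWord_inl,
      flatMap_writeWord_inl] at hI ⊢
    simp only [readWord, writeWord, List.append_assoc, List.map_append] at hI ⊢
    rw [hI]

/-- In the middle of a step, the current word of the derivation is `b ++ s`, where the part `s` is
still to be read and `b` is what the part already read has become. -/
theorem rewrites_of_index {G : RewriteGame B} {e : List B} (I : List G.DerivationIndex)
    (s b : List B) (h : I.flatMap G.readWord ++ (e.map some ++ [none]) =
      s.map some ++ none :: (b.map some ++ I.flatMap G.writeWord)) :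
    G.Rewrites (b ++ s) e := by
  have hs := Option.some_injective B
  have hn : ∀ b : B, some b ≠ none := fun b => by simp
  induction I generalizing s b with
  | nil =>
    obtain ⟨x', rfl, hy⟩ := List.exists_eq_append_of_map_append_cons_eq hs hn
      (x := e) (z := []) (by simpa using h)
    cases x' <;> cases b <;> simp_all
    exact .refl
  | cons i I ih =>
    rcases i with _ | a | ⟨⟨u, v⟩, hr⟩
    · cases s with
      | nil =>
        have := ih b [] (by simpa [readWord, writeWord] using h)
        simpa using this
      | cons c s => simp [readWord] at h
    · obtain ⟨x', rfl, hy⟩ := List.exists_eq_append_of_map_append_cons_eq hs hn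
        (x := s) (u := [a]) (by simpa [readWord] using h.symm)
      have := ih x' (b ++ [a]) (by simpa [writeWord] using hy)
      simpa using this
    · obtain ⟨x', rfl, hy⟩ := List.exists_eq_append_of_map_append_cons_eq hs hn
        (x := s) (u := u) (by simpa [readWord] using h.symm)
      have := ih x' (b ++ v) (by simpa [writeWord] using hy)
      have h1 := Rewrites.of_mem hr b x'
      simp only [List.append_assoc] at h1 this
      exact h1.trans this

/-- A word spells a derivation from `s` to `e` exactly when it satisfies both equations for some
list of indices. -/
theorem rewrites_iff_exists_index {G : RewriteGame B} {s e : List B} :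
    G.Rewrites s e ↔ ∃ (I : List G.DerivationIndex) (x : List (Option B)),
      x = I.flatMap G.readWord ++ (e.map some ++ [none]) ∧
      x = (s.map some ++ [none]) ++ I.flatMap G.writeWord := by
  constructor
  · intro h
    obtain ⟨I, hI⟩ := h.exists_index
    exact ⟨I, _, rfl, hI⟩
  · rintro ⟨I, x, rfl, h⟩
    simpa using rewrites_of_index I s [] (by simpa using h)

end RewriteGame

/-! ### Turing machines as rewriting systems -/

open Turing

/-- The letters of a word that describes a configuration of a Turing machine: tape symbols, states
(written just before the scanned symbol), the markers of the two ends of the used part of the tape,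
and a letter that appears when the machine halts. -/
inductive TapeLetter (Γ Λ : Type)
  | sym : Γ → TapeLetter Γ Λ
  | state : Λ → TapeLetter Γ Λ
  | border : TapeLetter Γ Λ
  | halted : TapeLetter Γ Λ

namespace TapeLetter

variable {Γ Λ : Type}

instance [Finite Γ] [Finite Λ] : Finite (TapeLetter Γ Λ) := by
  let f : Option (Option (Γ ⊕ Λ)) → TapeLetter Γ Λ
    | none => border
    | some none => halted
    | some (some (.inl a)) => sym a
    | some (some (.inr q)) => state q
  refine Finite.of_surjective f fun a => ?_
  cases a with
  | sym a => exact ⟨some (some (.inl a)), rfl⟩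
  | state q => exact ⟨some (some (.inr q)), rfl⟩
  | border => exact ⟨none, rfl⟩
  | halted => exact ⟨some none, rfl⟩

end TapeLetter

open TapeLetter

section

variable {Γ Λ : Type}

/-- The word that describes the configuration with state `q`, the symbols `r` at and on the right of
the head, and the symbols `l` on the left of the head, read from the head. -/
def cfgWord (q : Λ) (l r : List Γ) : List (TapeLetter Γ Λ) :=
  border :: l.reverse.map sym ++ state q :: (r.map sym ++ [border])

/-- The word that is reached when the machine has halted and its tape has been erased. -/
def haltedWord : List (TapeLetter Γ Λ) := [border, halted, border]

theorem map_sym_eq_append_sym_iff {l : List Γ} {b : Γ} {x : List (TapeLetter Γ Λ)} :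
    border :: l.reverse.map sym = x ++ [sym b] ↔
      ∃ l', l = b :: l' ∧ x = border :: l'.reverse.map sym := by
  cases l with
  | nil => simp [List.cons_eq_append_iff]
  | cons c l =>
    rw [List.reverse_cons, List.map_append, ← List.cons_append]
    constructor
    · intro h
      obtain ⟨h1, h2⟩ := List.append_inj' h rfl
      simp only [List.map_cons, List.map_nil, List.cons.injEq, sym.injEq, and_true] at h2
      exact ⟨l, by rw [h2], h1.symm⟩
    · rintro ⟨l', h, rfl⟩
      cases h
      rfl

theorem map_sym_eq_append_border_iff {l : List Γ} {x : List (TapeLetter Γ Λ)} :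
    border :: l.reverse.map sym = x ++ [border] ↔ l = [] ∧ x = [] := by
  cases l with
  | nil => simp
  | cons c l =>
    rw [List.reverse_cons, List.map_append, ← List.cons_append]
    refine iff_of_false (fun h => ?_) (by simp)
    simpa using (List.append_inj' h rfl).2

theorem map_sym_eq_sym_append_iff {r : List Γ} {a : Γ} {y : List (TapeLetter Γ Λ)} :
    r.map sym ++ [border] = [sym a] ++ y ↔ ∃ r', r = a :: r' ∧ y = r'.map sym ++ [border] := by
  cases r with
  | nil => simp
  | cons c r => simp [eq_comm]

theorem map_sym_eq_border_append_iff {r : List Γ} {y : List (TapeLetter Γ Λ)} :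
    r.map sym ++ [border] = [border] ++ y ↔ r = [] ∧ y = [] := by
  cases r with
  | nil => simp [eq_comm]
  | cons c r => simp

/-- A rule containing a state can only be applied at the state of a configuration word. -/
theorem cfgWord_eq_iff {q q' : Λ} {l r : List Γ} {x y p s : List (TapeLetter Γ Λ)} :
    cfgWord q l r = x ++ (p ++ state q' :: s) ++ y ↔
      border :: l.reverse.map sym = x ++ p ∧ q = q' ∧ r.map sym ++ [border] = s ++ y := by
  rw [cfgWord, show x ++ (p ++ state q' :: s) ++ y = (x ++ p) ++ state q' :: (s ++ y) by simp,
    List.append_cons_inj_of_notMem (by simp) (by simp), state.injEq]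

variable [Inhabited Γ]

/-- The configuration described by `cfgWord q l r`. -/
def wordCfg (q : Λ) (l r : List Γ) : TM0.Cfg Γ Λ :=
  ⟨q, Tape.mk' (ListBlank.mk l) (ListBlank.mk r)⟩

theorem wordCfg_nil_right (q : Λ) (l : List Γ) : wordCfg q l [] = wordCfg q l [default] := by
  have h := ListBlank.cons_head_tail (ListBlank.mk ([] : List Γ))
  simp only [ListBlank.head_mk, ListBlank.tail_mk, ListBlank.cons_mk, List.tail_nil] at h
  rw [wordCfg, wordCfg, ← h]
  rfl

theorem wordCfg_nil_left (q : Λ) (r : List Γ) : wordCfg q [] r = wordCfg q [default] r := by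
  have h := ListBlank.cons_head_tail (ListBlank.mk ([] : List Γ))
  simp only [ListBlank.head_mk, ListBlank.tail_mk, ListBlank.cons_mk, List.tail_nil] at h
  rw [wordCfg, wordCfg, ← h]
  rfl

variable [Inhabited Λ]

/-- The rewriting rules for the machine `M`. Besides its transitions, blanks may be added at both
ends of the used part of the tape, and the letter `halted` erases the tape. -/
inductive TapeRule (M : TM0.Machine Γ Λ) : List (TapeLetter Γ Λ) → List (TapeLetter Γ Λ) → Prop
  | left {q q' a} (b : Γ) (h : M q a = some (q', .move .left)) :
    TapeRule M [sym b, state q, sym a] [state q', sym b, sym a]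
  | right {q q' a} (h : M q a = some (q', .move .right)) :
    TapeRule M [state q, sym a] [sym a, state q']
  | write {q q' a b} (h : M q a = some (q', .write b)) :
    TapeRule M [state q, sym a] [state q', sym b]
  | halt {q a} (h : M q a = none) : TapeRule M [state q, sym a] [halted]
  | blankRight (q : Λ) : TapeRule M [state q, border] [state q, sym default, border]
  | blankLeft (q : Λ) : TapeRule M [border, state q] [border, sym default, state q]
  | eraseRight (a : Γ) : TapeRule M [halted, sym a] [halted]
  | eraseLeft (a : Γ) : TapeRule M [sym a, halted] [halted]

theorem TapeRule.ne_nil {M : TM0.Machine Γ Λ} {u v : List (TapeLetter Γ Λ)}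
    (h : TapeRule M u v) : u ≠ [] ∧ v ≠ [] := by
  cases h <;> simp

theorem finite_tapeRule [Finite Γ] [Finite Λ] (M : TM0.Machine Γ Λ) :
    {r : List (TapeLetter Γ Λ) × List (TapeLetter Γ Λ) | TapeRule M r.1 r.2}.Finite := by
  refine ((List.finite_length_le (TapeLetter Γ Λ) 3).prod
    (List.finite_length_le (TapeLetter Γ Λ) 3)).subset ?_
  rintro ⟨u, v⟩ h
  cases h <;> simp

/-- The rewriting system of the machine `M`. -/
noncomputable def tapeSystem [Finite Γ] [Finite Λ] (M : TM0.Machine Γ Λ) :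
    RewriteGame (TapeLetter Γ Λ) where
  rules := (finite_tapeRule M).toFinset.toList

theorem mem_tapeSystem_rules [Finite Γ] [Finite Λ] {M : TM0.Machine Γ Λ}
    {u v : List (TapeLetter Γ Λ)} : (u, v) ∈ (tapeSystem M).rules ↔ TapeRule M u v := by
  simp [tapeSystem]

theorem step_wordCfg (M : TM0.Machine Γ Λ) (q : Λ) (a : Γ) (l r : List Γ) :
    TM0.step M (wordCfg q l (a :: r)) = (M q a).map fun p => match p.2 with
      | .move .left => wordCfg p.1 l.tail (l.headI :: a :: r)
      | .move .right => wordCfg p.1 (a :: l) r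
      | .write c => wordCfg p.1 l (c :: r) := by
  simp only [TM0.step, wordCfg, Tape.mk'_head, ListBlank.head_mk, List.headI_cons]
  rcases hM : M q a with _ | ⟨q', (_ | _) | c⟩ <;> simp [← ListBlank.cons_mk]

/-- A rule applied to a configuration word leaves the configuration unchanged, or performs a step of
the machine, or shows that the machine has halted. -/
theorem TapeRule.sound {M : TM0.Machine Γ Λ} {u v x y : List (TapeLetter Γ Λ)}
    (hr : TapeRule M u v) {q : Λ} {l r : List Γ} (h : cfgWord q l r = x ++ u ++ y) :
    (∃ q' l' r', x ++ v ++ y = cfgWord q' l' r' ∧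
      StateTransition.Reaches (TM0.step M) (wordCfg q l r) (wordCfg q' l' r')) ∨
    TM0.step M (wordCfg q l r) = none := by
  cases hr with
  | @left q' q'' a b hM =>
    obtain ⟨h1, rfl, h2⟩ := (cfgWord_eq_iff (p := [sym b]) (s := [sym a])).1 h
    obtain ⟨l, rfl, rfl⟩ := map_sym_eq_append_sym_iff.1 h1
    obtain ⟨r, rfl, rfl⟩ := map_sym_eq_sym_append_iff.1 h2
    exact .inl ⟨q'', l, b :: a :: r, by simp [cfgWord],
      .single (by rw [step_wordCfg, hM]; rfl)⟩
  | @right q' q'' a hM =>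
    obtain ⟨h1, rfl, h2⟩ := (cfgWord_eq_iff (p := []) (s := [sym a])).1 h
    rw [List.append_nil] at h1
    obtain ⟨r, rfl, rfl⟩ := map_sym_eq_sym_append_iff.1 h2
    exact .inl ⟨q'', a :: l, r, by simp [cfgWord, ← h1],
      .single (by rw [step_wordCfg, hM]; rfl)⟩
  | @write q' q'' a b hM =>
    obtain ⟨h1, rfl, h2⟩ := (cfgWord_eq_iff (p := []) (s := [sym a])).1 h
    rw [List.append_nil] at h1
    obtain ⟨r, rfl, rfl⟩ := map_sym_eq_sym_append_iff.1 h2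
    exact .inl ⟨q'', l, b :: r, by simp [cfgWord, ← h1],
      .single (by rw [step_wordCfg, hM]; rfl)⟩
  | @halt q' a hM =>
    obtain ⟨h1, rfl, h2⟩ := (cfgWord_eq_iff (p := []) (s := [sym a])).1 h
    obtain ⟨r, rfl, rfl⟩ := map_sym_eq_sym_append_iff.1 h2
    exact .inr (by rw [step_wordCfg, hM]; rfl)
  | blankRight q' =>
    obtain ⟨h1, rfl, h2⟩ := (cfgWord_eq_iff (p := []) (s := [border])).1 h
    rw [List.append_nil] at h1
    obtain ⟨rfl, rfl⟩ := map_sym_eq_border_append_iff.1 h2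
    exact .inl ⟨q, l, [default], by simp [cfgWord, ← h1], by rw [wordCfg_nil_right]; exact .refl⟩
  | blankLeft q' =>
    obtain ⟨h1, rfl, h2⟩ := (cfgWord_eq_iff (p := [border]) (s := [])).1 h
    rw [List.nil_append] at h2
    obtain ⟨rfl, rfl⟩ := map_sym_eq_append_border_iff.1 h1
    exact .inl ⟨q, [default], r, by simp [cfgWord, ← h2], by rw [wordCfg_nil_left]; exact .refl⟩
  | eraseRight a =>
    have : halted ∈ cfgWord q l r := by rw [h]; simp
    simp [cfgWord] at this
  | eraseLeft a =>
    have : halted ∈ cfgWord q l r := by rw [h]; simp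
    simp [cfgWord] at this

variable [Finite Γ] [Finite Λ] {M : TM0.Machine Γ Λ}

theorem rewrites_of_tapeRule {u v : List (TapeLetter Γ Λ)} (h : TapeRule M u v)
    (x y : List (TapeLetter Γ Λ)) : (tapeSystem M).Rewrites (x ++ u ++ y) (x ++ v ++ y) :=
  .of_mem (mem_tapeSystem_rules.2 h) x y

/-- Blanks can be added so that the head scans a letter of the word. -/
theorem exists_rewrites_cons (q : Λ) (l r : List Γ) : ∃ b l' a r',
    (tapeSystem M).Rewrites (cfgWord q l r) (cfgWord q (b :: l') (a :: r')) ∧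
      wordCfg q l r = wordCfg q (b :: l') (a :: r') := by
  obtain ⟨a, r', h1, h2⟩ : ∃ a r', (tapeSystem M).Rewrites (cfgWord q l r)
      (cfgWord q l (a :: r')) ∧ wordCfg q l r = wordCfg q l (a :: r') := by
    cases r with
    | nil =>
      refine ⟨default, [], ?_, wordCfg_nil_right q l⟩
      simpa [cfgWord] using rewrites_of_tapeRule (M := M) (.blankRight q)
        (border :: l.reverse.map sym) []
    | cons a r => exact ⟨a, r, .refl, rfl⟩
  cases l with
  | nil =>
    refine ⟨default, [], a, r', h1.trans ?_, h2.trans (wordCfg_nil_left q _)⟩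
    simpa [cfgWord] using rewrites_of_tapeRule (M := M) (.blankLeft q) []
      (sym a :: (r'.map sym ++ [border]))
  | cons b l => exact ⟨b, l, a, r', h1, h2⟩

theorem rewrites_of_step {q : Λ} {l r : List Γ} {c : TM0.Cfg Γ Λ}
    (h : c ∈ TM0.step M (wordCfg q l r)) :
    ∃ q' l' r', c = wordCfg q' l' r' ∧
      (tapeSystem M).Rewrites (cfgWord q l r) (cfgWord q' l' r') := by
  obtain ⟨b, l', a, r', h1, h2⟩ := exists_rewrites_cons (M := M) q l r
  rw [h2, step_wordCfg, Option.mem_def, Option.map_eq_some_iff] at h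
  obtain ⟨⟨q', (_ | _) | d⟩, hM, rfl⟩ := h
  · refine ⟨q', _, _, rfl, h1.trans ?_⟩
    simpa [cfgWord] using rewrites_of_tapeRule (.left b hM) (border :: l'.reverse.map sym)
      (r'.map sym ++ [border])
  · refine ⟨q', _, _, rfl, h1.trans ?_⟩
    simpa [cfgWord] using rewrites_of_tapeRule (.right hM) (border :: (b :: l').reverse.map sym)
      (r'.map sym ++ [border])
  · refine ⟨q', _, _, rfl, h1.trans ?_⟩
    simpa [cfgWord] using rewrites_of_tapeRule (.write hM) (border :: (b :: l').reverse.map sym)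
      (r'.map sym ++ [border])

theorem rewrites_haltedWord (l r : List Γ) : (tapeSystem M).Rewrites
    (border :: l.reverse.map sym ++ halted :: (r.map sym ++ [border])) haltedWord := by
  induction r with
  | nil =>
    induction l with
    | nil => exact .refl
    | cons b l ih =>
      refine .trans ?_ ih
      simpa using rewrites_of_tapeRule (M := M) (.eraseLeft b) (border :: l.reverse.map sym)
        [border]
  | cons a r ih =>
    refine .trans ?_ ih
    simpa using rewrites_of_tapeRule (M := M) (.eraseRight a) (border :: l.reverse.map sym)
      (r.map sym ++ [border])

theorem rewrites_of_reaches {q : Λ} {l r : List Γ} {c : TM0.Cfg Γ Λ}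
    (h : StateTransition.Reaches (TM0.step M) (wordCfg q l r) c) (hc : TM0.step M c = none) :
    (tapeSystem M).Rewrites (cfgWord q l r) haltedWord := by
  generalize hd : wordCfg q l r = d at h
  induction h using Relation.ReflTransGen.head_induction_on generalizing q l r with
  | refl =>
    subst hd
    obtain ⟨b, l', a, r', h1, h2⟩ := exists_rewrites_cons (M := M) q l r
    rw [h2, step_wordCfg, Option.map_eq_none_iff] at hc
    refine h1.trans (.trans ?_ (rewrites_haltedWord (b :: l') r'))
    simpa [cfgWord] using rewrites_of_tapeRule (.halt hc) (border :: (b :: l').reverse.map sym)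
      (r'.map sym ++ [border])
  | head h _ ih =>
    subst hd
    obtain ⟨q', l', r', rfl, h'⟩ := rewrites_of_step h
    exact h'.trans (ih rfl)

theorem dom_of_rewrites {q : Λ} {l r : List Γ}
    (h : (tapeSystem M).Rewrites (cfgWord q l r) haltedWord) :
    (StateTransition.eval (TM0.step M) (wordCfg q l r)).Dom := by
  -- every word of a derivation describes a configuration that is reached, unless `M` halts
  have key : ∀ w, (tapeSystem M).Rewrites (cfgWord q l r) w →
      (∃ q' l' r', w = cfgWord q' l' r' ∧
        StateTransition.Reaches (TM0.step M) (wordCfg q l r) (wordCfg q' l' r')) ∨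
      (StateTransition.eval (TM0.step M) (wordCfg q l r)).Dom := by
    intro w hw
    induction hw with
    | refl => exact .inl ⟨q, l, r, rfl, .refl⟩
    | tail _ hw ih =>
      rcases ih with ⟨q', l', r', rfl, hreach⟩ | hdom
      · obtain ⟨u, v, x, y, hr, hx, rfl⟩ := hw
        rcases (mem_tapeSystem_rules.1 hr).sound hx with ⟨q'', l'', r'', h1, h2⟩ | hnone
        · exact .inl ⟨q'', l'', r'', h1, hreach.trans h2⟩
        · exact .inr (Part.dom_iff_mem.2 ⟨_, StateTransition.mem_eval.2 ⟨hreach, hnone⟩⟩)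
      · exact .inr hdom
  refine (key _ h).resolve_left ?_
  rintro ⟨q', l', r', hw, -⟩
  have : state q' ∈ (haltedWord : List (TapeLetter Γ Λ)) := by rw [hw]; simp [cfgWord]
  simp [haltedWord] at this

/-- The halting problem of the machine `M` as a reachability problem of its rewriting system. -/
theorem rewrites_haltedWord_iff (l : List Γ) :
    (tapeSystem M).Rewrites (cfgWord default [] l) haltedWord ↔ (TM0.eval M l).Dom := by
  constructor
  · exact dom_of_rewrites
  · intro h
    obtain ⟨c, hc⟩ := Part.dom_iff_mem.1 (show (StateTransition.eval (TM0.step M)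
      (wordCfg default [] l)).Dom from h)
    obtain ⟨h1, h2⟩ := StateTransition.mem_eval.1 hc
    exact rewrites_of_reaches h1 h2

end

/-! ### A Turing machine with an undecidable halting problem -/

namespace Turing

open PartrecToTM2

instance : Finite K' := by
  refine Finite.of_surjective (![.main, .rev, .aux, .stack] : Fin 4 → K') fun k => ?_
  cases k
  exacts [⟨0, rfl⟩, ⟨1, rfl⟩, ⟨2, rfl⟩, ⟨3, rfl⟩]

/-- A machine supported by a finite set of states has the same halting problem as one with finitely
many states. -/
theorem TM0.exists_finite_of_supports {Γ Λ : Type} [Inhabited Γ] [Inhabited Λ]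
    (M : TM0.Machine Γ Λ) (S : Set Λ) [Finite S] (hS : TM0.Supports M S) :
    ∃ (Λ' : Type) (_ : Inhabited Λ') (_ : Finite Λ') (M' : TM0.Machine Γ Λ'),
      ∀ l, (TM0.eval M' l).Dom ↔ (TM0.eval M l).Dom := by
  classical
  let _ : Inhabited S := ⟨⟨default, hS.1⟩⟩
  let g : PointedMap Λ S :=
    ⟨fun q => if h : q ∈ S then ⟨q, h⟩ else default, by simp [hS.1]; rfl⟩
  let i : PointedMap Γ Γ := ⟨id, rfl⟩
  have hg : ∀ q ∈ S, (Subtype.val (g q) : Λ) = q := fun q hq => by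
    change Subtype.val (if h : q ∈ S then (⟨q, h⟩ : S) else default) = q
    simp [hq]
  refine ⟨S, inferInstance, inferInstance, M.map i i g Subtype.val, fun l => ?_⟩
  refine StateTransition.tr_eval_dom (TM0.Machine.map_respects M i i g Subtype.val hS
    (fun _ => rfl) hg) ⟨hS.1, ?_⟩
  rw [TM0.map_init]
  exact congrArg _ (List.map_id l)

theorem TM2to1.trInit_of_reverse_eq_cons {K : Type} [DecidableEq K] {Γ : K → Type} {k : K}
    {L l : List (Γ k)} {a : Γ k} (h : L.reverse = a :: l) :
    TM2to1.trInit k L = (true, Function.update (fun _ => none) k (some a)) ::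
      l.map fun a => (false, Function.update (fun _ => none) k (some a)) := by
  rw [TM2to1.trInit, h]
  rfl

theorem PartrecToTM2.trNat_eq {x : ℕ} (hx : x ≠ 0) :
    trNat x = (if x % 2 = 1 then Γ'.bit1 else Γ'.bit0) :: trNat (x / 2) := by
  obtain ⟨n, rfl⟩ : ∃ n : Num, (n : ℕ) = x := ⟨x, Num.to_of_nat x⟩
  have hpos : ∀ p : PosNum, trNat (p : ℕ) = trPosNum p := fun p => by
    have : ((p : ℕ) : Num) = .pos p := Num.of_to_nat (.pos p)
    rw [trNat, this, trNum]
  rcases n with _ | p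
  · exact absurd rfl hx
  change trNat (p : ℕ) = (if (p : ℕ) % 2 = 1 then Γ'.bit1 else Γ'.bit0) :: trNat ((p : ℕ) / 2)
  cases p with
  | one => rw [hpos]; simp [trPosNum, trNat_zero]
  | bit0 p =>
    have h1 : ((p.bit0 : PosNum) : ℕ) % 2 ≠ 1 := by rw [PosNum.cast_bit0]; omega
    have h2 : ((p.bit0 : PosNum) : ℕ) / 2 = p := by rw [PosNum.cast_bit0]; omega
    rw [if_neg h1, h2, hpos, hpos, trPosNum]
  | bit1 p =>
    have h1 : ((p.bit1 : PosNum) : ℕ) % 2 = 1 := by rw [PosNum.cast_bit1]; omega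
    have h2 : ((p.bit1 : PosNum) : ℕ) / 2 = p := by rw [PosNum.cast_bit1]; omega
    rw [if_pos h1, h2, hpos, hpos, trPosNum]

/-- Strong recursion on `x`, halving it to split off the lowest digit. -/
theorem PartrecToTM2.primrec_map_trNat {α : Type} [Primcodable α] (f : Γ' → α) :
    Primrec fun x => (trNat x).map f := by
  have h : Primrec₂ fun (_ : Unit) x => (trNat x).map f := by
    refine Primrec.nat_strong_rec _ (g := fun _ l => if l.length = 0 then some [] else
      (l[l.length / 2]?).map fun t =>
        (if l.length % 2 = 1 then f Γ'.bit1 else f Γ'.bit0) :: t) ?_ fun _ n => ?_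
    · have hlen : Primrec fun p : Unit × List (List α) => p.2.length :=
        Primrec.list_length.comp Primrec.snd
      refine Primrec.ite (Primrec.eq.comp hlen (Primrec.const 0)) (Primrec.const _)
        (Primrec.option_map (Primrec.list_getElem?.comp Primrec.snd
          (Primrec.nat_div.comp hlen (Primrec.const 2))) ?_)
      refine Primrec.list_cons.comp (Primrec.ite (Primrec.eq.comp (Primrec.nat_mod.comp
        (hlen.comp Primrec.fst) (Primrec.const 2)) (Primrec.const 1)) (Primrec.const _)
        (Primrec.const _)) Primrec.snd
    · rcases Nat.eq_zero_or_pos n with rfl | hn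
      · simp [trNat_zero]
      · have hlt : n / 2 < n := Nat.div_lt_self hn (by norm_num)
        simp only [List.length_map, List.length_range, hn.ne', if_false, List.getElem?_map,
          List.getElem?_range hlt, Option.map_some, trNat_eq hn.ne', List.map_cons]
        split_ifs <;> rfl
  exact h.comp (Primrec.const ()) Primrec.id

/-- Some Turing machine with finitely many symbols and states has an undecidable halting problem,
for inputs that are computed by a primitive recursive function. -/
theorem exists_machine_not_computablePred :
    ∃ (Γ Λ : Type) (_ : Inhabited Γ) (_ : Finite Γ) (_ : Inhabited Λ) (_ : Finite Λ)
      (M : TM0.Machine Γ Λ) (input : ℕ → List Γ),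
      (∀ f : Γ → ℕ, Primrec fun x => (input x).map f) ∧
      ¬ ComputablePred fun x => (TM0.eval M (input x)).Dom := by
  classical
  -- a code whose domain is the halting set
  let g : ℕ →. ℕ := fun x => Nat.Partrec.Code.eval (Denumerable.ofNat Nat.Partrec.Code x) 0
  have hg : Partrec g :=
    Nat.Partrec.Code.eval_part.comp (Computable.ofNat _) (Computable.const 0)
  obtain ⟨c, hc⟩ := ToPartrec.Code.exists_code (Nat.Partrec'.part_iff₁.2 hg)
  have hc' : ∀ x, (c.eval [x]).Dom ↔ (g x).Dom := by
    intro x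
    have := hc ⟨[x], rfl⟩
    simp only at this
    rw [this]
    rfl
  let _ : Inhabited Λ' := ⟨trNormal c Cont'.halt⟩
  let _ : Fintype K' := Fintype.ofFinite _
  have hsupp := TM1to0.tr_supports _ (TM2to1.tr_supports tr (tr_supports c Cont'.halt))
  obtain ⟨Λ₀, i1, i2, M, hM⟩ := TM0.exists_finite_of_supports _ _ hsupp
  refine ⟨_, Λ₀, inferInstance, ?_, i1, i2, M,
    fun x => TM2to1.trInit K'.main (trList [x]), fun f => ?_, fun h => ?_⟩
  · exact inferInstanceAs (Finite (Bool × (K' → Option Γ')))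
  · have hinit : ∀ x, (TM2to1.trInit K'.main (trList [x]) :
        List (TM2to1.Γ' K' fun _ => Γ')).map f =
        f (true, Function.update (fun _ => none) K'.main (some Γ'.cons)) ::
          ((trNat x).map fun a =>
            f (false, Function.update (fun _ => none) K'.main (some a))).reverse := by
      intro x
      have hrev : (trList [x]).reverse = Γ'.cons :: (trNat x).reverse := by simp [trList]
      rw [TM2to1.trInit_of_reverse_eq_cons hrev, ← List.map_reverse]
      exact congrArg (f _ :: ·) List.map_map
    simp only [hinit]
    exact Primrec.list_cons.comp (Primrec.const _)
      (Primrec.list_reverse.comp (primrec_map_trNat _))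
  · refine ComputablePred.halting_problem 0 ?_
    have hdom : ∀ x, (TM0.eval M (TM2to1.trInit K'.main (trList [x]))).Dom ↔ (g x).Dom := by
      intro x
      rw [hM, TM1to0.tr_eval, ← hc']
      refine (TM2to1.tr_eval_dom (tr : Λ' → TM2.Stmt (fun _ : K' => Γ') Λ' (Option Γ')) K'.main
        (trList [x])).trans ?_
      have hstk : (TM2.init K'.main (trList [x]) :
          TM2.Cfg (fun _ : K' => Γ') Λ' (Option Γ')) = init c [x] := by
        refine congrArg (TM2.Cfg.mk _ _) (funext fun k => ?_)
        cases k <;> rfl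
      change (StateTransition.eval (TM2.step tr) (TM2.init K'.main (trList [x]))).Dom ↔ _
      rw [hstk, tr_eval]
      rfl
    refine ComputablePred.computable_of_manyOneReducible ⟨Encodable.encode, Computable.encode,
      fun a => ?_⟩ h
    rw [hdom]
    simp [g]

end Turing

/-! ### Presentations of star-free languages -/

namespace Language

variable {A : Type} {L M : Language A}

theorem IsRegular.zero : (0 : Language A).IsRegular := by
  refine .of_finite_range_leftQuotient (Set.finite_singleton (0 : Language A) |>.subset ?_)
  rintro _ ⟨x, rfl⟩
  exact Set.ext fun y => Iff.rfl

/-- A singleton has finitely many left quotients, each of them being empty or a suffix of its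
word. -/
theorem IsRegular.singleton (w : List A) : ({w} : Language A).IsRegular := by
  refine .of_finite_range_leftQuotient
    (((w.tails.map fun v => ({v} : Language A)).finite_toSet.insert (0 : Language A)).subset ?_)
  rintro _ ⟨x, rfl⟩
  by_cases h : x <+: w
  · obtain ⟨v, rfl⟩ := h
    refine .inr (List.mem_map.2 ⟨v, by simp, ?_⟩)
    ext y
    rw [mem_leftQuotient]
    exact (List.append_right_inj x).symm
  · refine .inl (Set.ext fun y => iff_of_false (fun hy => h ⟨y, ?_⟩) id)
    exact hy

/-- The left quotients of `L * M` are built from a left quotient of `L` and a set of left quotients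
of `M`, one for each way to split the divisor with its first part in `L`. -/
theorem IsRegular.mul (hL : L.IsRegular) (hM : M.IsRegular) : (L * M).IsRegular := by
  have h := (hL.finite_range_leftQuotient.prod hM.finite_range_leftQuotient.finite_subsets).image
    fun p : Language A × Set (Language A) => p.1 * M + sSup p.2
  refine .of_finite_range_leftQuotient (h.subset ?_)
  rintro _ ⟨x, rfl⟩
  refine ⟨(L.leftQuotient x, {N | ∃ a b, a ++ b = x ∧ a ∈ L ∧ N = M.leftQuotient b}),
    ⟨⟨x, rfl⟩, ?_⟩, ?_⟩
  · rintro _ ⟨a, b, -, -, rfl⟩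
    exact ⟨b, rfl⟩
  · ext y
    simp only [mem_leftQuotient, mem_add]
    rw [mem_mul, mem_mul]
    constructor
    · rintro (⟨a, ha, b, hb, rfl⟩ | ⟨_, ⟨a, b, rfl, ha, rfl⟩, hy⟩)
      · exact ⟨x ++ a, ha, b, hb, by simp⟩
      · exact ⟨a, ha, b ++ y, hy, by simp⟩
    · rintro ⟨a, ha, b, hb, h⟩
      rcases List.append_eq_append_iff.1 h with ⟨c, rfl, rfl⟩ | ⟨c, rfl, rfl⟩
      · exact .inr ⟨_, ⟨a, c, rfl, ha, rfl⟩, hb⟩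
      · exact .inl ⟨c, ha, b, hb, rfl⟩

end Language

theorem StarFreeExpr.isRegular_lang {A : Type} (e : StarFreeExpr A) : e.lang.IsRegular := by
  induction e with
  | empty => exact .zero
  | epsilon => exact .singleton []
  | letter a => exact .singleton [a]
  | union e f he hf => exact he.add hf
  | concat e f he hf => exact he.mul hf
  | compl e he => exact he.compl

namespace StarFreeExpr

variable {A : Type}

theorem mem_lang_compl {e : StarFreeExpr A} {w : List A} : w ∈ e.compl.lang ↔ w ∉ e.lang := Iff.rfl

/-- The words of length one with a letter in `P`. -/
def ofLetters (P : List A) : StarFreeExpr A := P.foldr (fun a e => union (letter a) e) empty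

theorem mem_lang_ofLetters {P : List A} {w : List A} :
    w ∈ (ofLetters P).lang ↔ ∃ a ∈ P, w = [a] := by
  induction P with
  | nil => simp [ofLetters, lang]
  | cons a P ih =>
    change w ∈ (letter a).lang + (ofLetters P).lang ↔ _
    rw [Language.mem_add, ih]
    simp only [List.mem_cons, exists_eq_or_imp]
    rfl

/-- The words with no letter in `P`. -/
def avoiding (P : List A) : StarFreeExpr A :=
  compl (concat (compl empty) (concat (ofLetters P) (compl empty)))

theorem mem_lang_avoiding {P : List A} {w : List A} :
    w ∈ (avoiding P).lang ↔ ∀ a ∈ w, a ∉ P := by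
  have htop : ∀ w : List A, w ∈ (compl empty).lang := fun w h => h
  rw [avoiding, mem_lang_compl, ← not_iff_not, not_not]
  push Not
  simp only [lang]
  constructor
  · rintro ⟨x, -, _, ⟨_, hb, y, -, rfl⟩, rfl⟩
    obtain ⟨a, ha, rfl⟩ := mem_lang_ofLetters.1 hb
    exact ⟨a, by simp, ha⟩
  · rintro ⟨a, ha, hP⟩
    obtain ⟨x, y, rfl⟩ := List.append_of_mem ha
    exact ⟨x, htop x, a :: y, ⟨[a], mem_lang_ofLetters.2 ⟨a, hP, rfl⟩, y, htop y, rfl⟩, rfl⟩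

/-- The word `w` as an expression. -/
def word (w : List A) : StarFreeExpr A := w.foldr (fun a e => concat (letter a) e) epsilon

theorem lang_word (w : List A) : (word w).lang = {w} := by
  induction w with
  | nil => rfl
  | cons a w ih =>
    change {[a]} * (word w).lang = ({a :: w} : Language A)
    rw [ih]
    exact Set.image2_singleton

end StarFreeExpr

namespace RegularExpression

variable {A : Type}

/-- The word `w` as an expression. -/
def word (w : List A) : RegularExpression A := w.foldr (fun a e => char a * e) 1

theorem matches'_word (w : List A) : (word w).matches' = {w} := by
  induction w with
  | nil => rfl
  | cons a w ih =>
    change {[a]} * (word w).matches' = ({a :: w} : Language A)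
    rw [ih]
    exact Set.image2_singleton

/-- The words of length one with a letter in `P`. -/
def ofLetters (P : List A) : RegularExpression A := P.foldr (fun a e => char a + e) 0

theorem matches'_ofLetters (P : List A) :
    (ofLetters P).matches' = (StarFreeExpr.ofLetters P).lang := by
  induction P with
  | nil => rfl
  | cons a P ih => exact congrArg ({[a]} + · : Language A → Language A) ih

theorem mem_matches'_star_ofLetters {P : List A} {w : List A} :
    w ∈ (star (ofLetters P)).matches' ↔ ∀ a ∈ w, a ∈ P := by
  rw [matches'_star, matches'_ofLetters, Language.mem_kstar]
  constructor
  · rintro ⟨L, rfl, hL⟩ a ha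
    obtain ⟨y, hy, hay⟩ := List.mem_flatten.1 ha
    obtain ⟨b, hb, rfl⟩ := StarFreeExpr.mem_lang_ofLetters.1 (hL y hy)
    rwa [List.mem_singleton.1 hay]
  · intro h
    refine ⟨w.map fun a => [a], by simp [← List.flatMap_def], fun y hy => ?_⟩
    obtain ⟨a, ha, rfl⟩ := List.mem_map.1 hy
    exact StarFreeExpr.mem_lang_ofLetters.2 ⟨a, h a ha, rfl⟩

end RegularExpression

/-- The words `l α m β r` with fixed letters `l`, `r` and a fixed word `m`, where the letters of `α`
are in `P` and those of `β` are in `Q`. -/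
def framedLanguage {A : Type} (l : A) (m : List A) (r : A) (P Q : Set A) : Language A :=
  {w | ∃ α β, (∀ a ∈ α, a ∈ P) ∧ (∀ a ∈ β, a ∈ Q) ∧ w = l :: (α ++ (m ++ (β ++ [r])))}

section Framed

variable {A : Type} {l r : A} {m : List A} {P Q : Set A}

theorem framedLanguage_eq_of_mem_iff {X Y : Language A} (hX : ∀ w, w ∈ X ↔ ∀ a ∈ w, a ∈ P)
    (hY : ∀ w, w ∈ Y ↔ ∀ a ∈ w, a ∈ Q) :
    {[l]} * (X * ({m} * (Y * {[r]}))) = framedLanguage l m r P Q := by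
  ext w
  constructor
  · rintro ⟨_, rfl, _, ⟨α, hα, _, ⟨_, rfl, _, ⟨β, hβ, _, rfl, rfl⟩, rfl⟩, rfl⟩, rfl⟩
    exact ⟨α, β, (hX α).1 hα, (hY β).1 hβ, rfl⟩
  · rintro ⟨α, β, hα, hβ, rfl⟩
    exact ⟨[l], rfl, _, ⟨α, (hX α).2 hα, _, ⟨m, rfl, _, ⟨β, (hY β).2 hβ, [r], rfl, rfl⟩, rfl⟩,
      rfl⟩, rfl⟩

variable [Finite A]

theorem exists_starFreeExpr_framedLanguage (l : A) (m : List A) (r : A) (P Q : Set A) :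
    ∃ e : StarFreeExpr A, e.lang = framedLanguage l m r P Q := by
  have key : ∀ P : Set A, ∃ e : StarFreeExpr A, ∀ w, w ∈ e.lang ↔ ∀ a ∈ w, a ∈ P := fun P =>
    ⟨.avoiding (Pᶜ.toFinite.toFinset.toList), fun w => by simp [StarFreeExpr.mem_lang_avoiding]⟩
  obtain ⟨x, hx⟩ := key P
  obtain ⟨y, hy⟩ := key Q
  exact ⟨.concat (.letter l) (.concat x (.concat (.word m) (.concat y (.letter r)))), by
    rw [← framedLanguage_eq_of_mem_iff hx hy, ← StarFreeExpr.lang_word m]; rfl⟩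

theorem exists_regularExpression_framedLanguage (l : A) (m : List A) (r : A) (P Q : Set A) :
    ∃ e : RegularExpression A, e.matches' = framedLanguage l m r P Q := by
  have key : ∀ P : Set A, ∃ e : RegularExpression A, ∀ w, w ∈ e.matches' ↔ ∀ a ∈ w, a ∈ P :=
    fun P => ⟨.star (.ofLetters P.toFinite.toFinset.toList), fun w => by
      simp only [RegularExpression.mem_matches'_star_ofLetters, Finset.mem_toList,
        Set.Finite.mem_toFinset]⟩
  obtain ⟨x, hx⟩ := key P
  obtain ⟨y, hy⟩ := key Q
  exact ⟨.comp (.char l) (.comp x (.comp (.word m) (.comp y (.char r)))), by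
    rw [← framedLanguage_eq_of_mem_iff hx hy, ← RegularExpression.matches'_word m]; rfl⟩

end Framed

theorem StarFreeExpr.exists_dfa {A : Type} (e : StarFreeExpr A) :
    ∃ M : Σ k : ℕ, DFA A (Fin k), M.2.accepts = e.lang := by
  obtain ⟨σ, _, M, hM⟩ := e.isRegular_lang
  exact ⟨⟨_, DFA.reindex (Fintype.equivFin σ) M⟩, by simp [hM]⟩

/-! ### The reduction -/

namespace RewriteGame

variable {A B : Type}

/-- The game obtained by renaming the letters. -/
def map (f : A → B) (G : RewriteGame A) : RewriteGame B where
  rules := G.rules.map fun r => (r.1.map f, r.2.map f)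

theorem map_move_iff {f : A → B} (hf : Function.Injective f) {G : RewriteGame A} {w : List A}
    {z : List B} : (G.map f).Move (w.map f) z ↔ ∃ w', z = w'.map f ∧ G.Move w w' := by
  constructor
  · rintro ⟨_, _, x, y, hr, h, rfl⟩
    obtain ⟨⟨u, v⟩, huv_mem, huv⟩ := List.mem_map.1 hr
    obtain ⟨rfl, rfl⟩ := Prod.mk.inj huv
    obtain ⟨a, y', rfl, h1, rfl⟩ := List.map_eq_append_iff.1 h
    obtain ⟨x', u', rfl, rfl, h2⟩ := List.map_eq_append_iff.1 h1
    cases List.map_injective_iff.2 hf h2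
    exact ⟨x' ++ v ++ y', by simp, u, v, x', y', huv_mem, rfl, rfl⟩
  · rintro ⟨_, rfl, u, v, x, y, hr, rfl, rfl⟩
    exact ⟨u.map f, v.map f, x.map f, y.map f, List.mem_map_of_mem hr, by simp, by simp⟩

theorem map_isNPosition_iff {f : A → B} (hf : Function.Injective f) {G : RewriteGame A}
    {w : List A} : (G.map f).IsNPosition (w.map f) ↔ G.IsNPosition w := by
  constructor
  · intro h
    generalize hz : w.map f = z at h
    induction h generalizing w with
    | intro z z' hmove _ ih =>
      subst hz
      obtain ⟨w', rfl, hw'⟩ := (map_move_iff hf).1 hmove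
      exact ⟨w, w', hw', fun w'' h => ih _ ((map_move_iff hf).2 ⟨w'', rfl, h⟩) rfl⟩
  · intro h
    induction h with
    | intro w w' hmove _ ih =>
      refine ⟨_, w'.map f, (map_move_iff hf).2 ⟨w', rfl, hmove⟩, fun z hz => ?_⟩
      obtain ⟨w'', rfl, h⟩ := (map_move_iff hf).1 hz
      exact ih w'' h

theorem StronglyTerminating.map {G : RewriteGame A} (hG : G.StronglyTerminating) (f : A → B) :
    (G.map f).StronglyTerminating := by
  intro u v h
  obtain ⟨⟨u, v⟩, hr, huv⟩ := List.mem_map.1 h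
  obtain ⟨rfl, rfl⟩ := Prod.mk.inj huv
  simpa using hG u v hr

end RewriteGame

open GameLetter

/-- The language of the words `comparisonWord I x`, after renaming of the letters. -/
theorem mem_framedLanguage_iff {ι T A : Type} {f : GameLetter ι T → A} {w : List A} :
    w ∈ framedLanguage (f leftEnd) ([ctrl .start, pad, pad].map f) (f rightEnd)
      (Set.range fun i => f (idx i)) (Set.range fun t => f (txt t)) ↔
      ∃ I x, w = (comparisonWord I x).map f := by
  constructor
  · rintro ⟨α, β, hα, hβ, rfl⟩
    obtain ⟨I, rfl⟩ : α ∈ Set.range (List.map fun i => f (idx i)) := by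
      rw [Set.range_list_map]; exact hα
    obtain ⟨x, rfl⟩ : β ∈ Set.range (List.map fun t => f (txt t)) := by
      rw [Set.range_list_map]; exact hβ
    exact ⟨I.reverse, x, by simp [comparisonWord, leftPart, rightPart, Function.comp_def]⟩
  · rintro ⟨I, x, rfl⟩
    exact ⟨I.reverse.map fun i => f (idx i), x.map fun t => f (txt t), by simp, by simp,
      by simp [comparisonWord, leftPart, rightPart, Function.comp_def]⟩

theorem exists_mem_framedLanguage_isNPosition_iff {ι T A : Type} [Fintype ι] {u v : ι → List T}
    {e s : List T} {f : GameLetter ι T → A} (hf : Function.Injective f) :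
    (∃ w ∈ framedLanguage (f leftEnd) ([ctrl .start, pad, pad].map f) (f rightEnd)
      (Set.range fun i => f (idx i)) (Set.range fun t => f (txt t)),
      ((comparisonGame u v e s).map f).IsNPosition w) ↔
    ∃ (I : List ι) (x : List T), x = I.flatMap u ++ e ∧ x = s ++ I.flatMap v := by
  simp only [mem_framedLanguage_iff]
  constructor
  · rintro ⟨_, ⟨I, x, rfl⟩, h⟩
    exact ⟨I, x, isNPosition_comparisonWord_iff.1 ((RewriteGame.map_isNPosition_iff hf).1 h)⟩
  · rintro ⟨I, x, h⟩
    exact ⟨_, ⟨I, x, rfl⟩,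
      (RewriteGame.map_isNPosition_iff hf).2 (isNPosition_comparisonWord_iff.2 h)⟩

/-- Only the left-hand side of one reduction depends on `s`, so that the code of the game is
computable from `s`. -/
theorem primrec_code_comparisonGame {ι T : Type} [Fintype ι] {u v : ι → List T} {e : List T}
    {s : ℕ → List T} (hs : ∀ g : T → ℕ, Primrec fun k => (s k).map g) {n : ℕ}
    (f : GameLetter ι T → Fin n) :
    Primrec fun k => ((comparisonGame u v e (s k)).map f).code := by
  have h : ∀ k, ((comparisonGame u v e (s k)).map f).code =
      ((f (ctrl .botInit) : ℕ) :: (s k).map (fun t => (f (txt t) : ℕ)),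
        ([ctrl .botWait, pad].map f).map Fin.val) ::
      ((comparisonGame u v e []).map f).code.tail := by
    intro k
    simp [RewriteGame.code, RewriteGame.map, comparisonGame, Function.comp_def]
  simp only [h]
  exact Primrec.list_cons.comp (Primrec.pair (Primrec.list_cons.comp (Primrec.const _) (hs _))
    (Primrec.const _)) (Primrec.const _)

/-- If every language `l · P* · m · Q* · r` has a presentation, the problem is undecidable. -/
theorem not_decidableNPositionInStarFree (P : LanguagePresentation)
    (hP : ∀ (n : ℕ) (l : Fin n) (m : List (Fin n)) (r : Fin n) (S T : Set (Fin n)),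
      ∃ x : P.Obj n, P.lang x = framedLanguage l m r S T) :
    ¬ DecidableNPositionInStarFree P := by
  classical
  rintro ⟨d, hd, hcorrect⟩
  obtain ⟨Γ, Λ, _, _, _, _, M, input, hinput, hhalt⟩ := Turing.exists_machine_not_computablePred
  refine hhalt ?_
  let R := tapeSystem M
  let T := Option (TapeLetter Γ Λ)
  let _ : Fintype R.DerivationIndex := Fintype.ofFinite _
  obtain ⟨n, ⟨f⟩⟩ := Finite.exists_equiv_fin (GameLetter R.DerivationIndex T)
  let s : ℕ → List T := fun k => (cfgWord default [] (input k)).map some ++ [none]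
  let e : List T := haltedWord.map some ++ [none]
  let G : ℕ → RewriteGame (Fin n) := fun k =>
    (comparisonGame R.readWord R.writeWord e (s k)).map f
  obtain ⟨x, hx⟩ := hP n (f leftEnd) ([ctrl .start, pad, pad].map f) (f rightEnd)
    (Set.range fun i => f (idx i)) (Set.range fun t => f (txt t))
  have hne : ∀ i, R.readWord i ≠ [] ∧ R.writeWord i ≠ [] := by
    rintro (_ | _ | ⟨⟨u, v⟩, hr⟩)
    · simp [RewriteGame.readWord, RewriteGame.writeWord]
    · simp [RewriteGame.readWord, RewriteGame.writeWord]
    · simpa [RewriteGame.readWord, RewriteGame.writeWord] using (mem_tapeSystem_rules.1 hr).ne_nil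
  have hterm : ∀ k, (G k).StronglyTerminating := fun k =>
    (comparisonGame_stronglyTerminating (fun i => (hne i).1) (fun i => (hne i).2)
      (by simp [s, cfgWord])).map f
  have hstar : IsStarFree (P.lang x) := by
    rw [hx]; exact exists_starFreeExpr_framedLanguage _ _ _ _ _
  have hiff : ∀ k, (∃ w, w ∈ P.lang x ∧ (G k).IsNPosition w) ↔
      (Turing.TM0.eval M (input k)).Dom := fun k => by
    rw [hx, ← rewrites_haltedWord_iff, RewriteGame.rewrites_iff_exists_index]
    exact exists_mem_framedLanguage_isNPosition_iff f.injective
  have hs : ∀ g : T → ℕ, Primrec fun k => (s k).map g := by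
    intro g
    have h : ∀ k, (s k).map g =
        [g (some .border), g (some (.state default))] ++
          ((input k).map (fun a => g (some (.sym a))) ++ [g (some .border), g none]) := by
      intro k
      simp [s, cfgWord, Function.comp_def]
    simp only [h]
    exact Primrec.list_append.comp (Primrec.const _)
      (Primrec.list_append.comp (hinput _) (Primrec.const _))
  have hcomp : Partrec fun k => d (n, (G k).code, P.code x) :=
    hd.comp ((Computable.const n).pair
      ((primrec_code_comparisonGame hs f).to_comp.pair (Computable.const _)))
  refine ⟨fun _ => Classical.dec _, hcomp.of_eq fun k => ?_⟩
  obtain ⟨b, hb, hb'⟩ := hcorrect n (G k) x (hterm k) hstar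
  rw [hiff] at hb'
  rw [Part.eq_some_iff.2 hb]
  congr 1
  rw [Bool.eq_iff_iff, decide_eq_true_iff]
  exact hb'

theorem theorem5 :
    ¬ DecidableNPositionInStarFree LanguagePresentation.byStarFreeExpr ∧
    ¬ DecidableNPositionInStarFree LanguagePresentation.byRegularExpression ∧
    ¬ DecidableNPositionInStarFree LanguagePresentation.byDFA := by
  refine ⟨not_decidableNPositionInStarFree _ fun n l m r S T => ?_,
    not_decidableNPositionInStarFree _ fun n l m r S T => ?_,
    not_decidableNPositionInStarFree _ fun n l m r S T => ?_⟩
  · exact exists_starFreeExpr_framedLanguage l m r S T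
  · exact exists_regularExpression_framedLanguage l m r S T
  · obtain ⟨e, he⟩ := exists_starFreeExpr_framedLanguage l m r S T
    obtain ⟨M, hM⟩ := e.exists_dfa
    exact ⟨M, hM.trans he⟩
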